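/- **Setting.** Let $\mathcal D\subseteq\mathbb R^{n}$ be a Borel set, $\mathcal Y$ a finite set of outputs, $f:\mathcal D\to\mathbb R^{n}$ Borel measurable and $h:\mathcal D\to\mathcal Y$ measurable. The system $\Sigma(x)$ is $x_0=x$, $x_{k+1}=f(x_k)$, $y_k=h(x_k)$; from the first time at which the state leaves $\mathcal D$, the output equals a fixed symbol $y^\dagger\in\mathcal Y$ forever. Let $\mathcal P$ be a probability measure on $\mathcal D$, and write $\mathcal B_H(x)=\{(y_0,\dots,y_{H-1})\}$ for the $H$-long behaviour of $\Sigma(x)$, viewed as the set of $H$-long output sequences of the transition system that embeds $\Sigma$, started at $x$. Let $1\le\ell\le H$, $N\ge 1$ and $\beta\in(0,1)$. **Abstraction.** For $\omega=(x_{0,1},\dots,x_{0,N})\in\mathcal D^N$ let $\mathcal X_\ell^N$ be the set of all words in $\mathcal Y^\ell$ that occur as blocks of $\ell$ consecutive letters in one of the trajectories $\mathcal B_H(x_{0,1}),\dots,\mathcal B_H(x_{0,N})$. The data-driven $\ell$-complete abstraction $\mathcal S^N_\ell$ is the transition system whose states are the words in the domino completion of $\mathcal X_\ell^N$, whose initial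 states are the words in $\mathcal X_\ell^N$, whose transitions are all pairs of states of the form $(k\sigma,\sigma k')$ with $k,k'\in\mathcal Y$, $\sigma\in\mathcal Y^{\ell-1}$, and in which the state $k\sigma$ has output $k$. The domino completion is obtained by adding, for each state $k\sigma$ without an outgoing transition, all words $\sigma k'$ ($k'\in\mathcal Y$), and repeating this until no state is blocking (nothing is added if no state is blocking). $\mathcal B_H(\mathcal S_\ell^N)$ denotes the set of output sequences of all runs $q_0q_1\cdots q_{H-1}$ of $\mathcal S_\ell^N$ that start in an initial state. **Complexity and bound.** Let $s^*_N=s^*_N(\omega)$ be the least cardinality of a set $I\subseteq\{1,\dots,N\}$ such that the trajectories with index in $I$ yield the same set of observed $\ell$-sequences $\mathcal X^N_\ell$ as all $N$ trajectories. For $k<N$ let $\epsilon(k,N,\beta)$ be the unique $\epsilon\in(0,1)$ with $$\binom Nk(1-\epsilon)^{N-k}=\frac{\beta}{N}\sum_{m=k}^{N-1}\binom mk(1-\epsilon)^{m-k},$$ and let $\epsilon(N,N,\beta)=1$. **Proposition.** If $x_{0,1},\dots,x_{0,N}$ are drawn independently from $\mathcal P$, then $$\mathcal P^N\Big[\ \mathcal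 P\big[\,x_0\in\mathcal D:\ \mathcal B_H(x_0)\subseteq\mathcal B_H(\mathcal S^N_\ell)\,\big]\ \ge\ 1-\epsilon(s^*_N,N,\beta)\ \Big]\ \ge\ 1-\beta .$$ -/

import Mathlib

open MeasureTheory

/-! ### Sequences -/

/-- The sequence `r` of length `m` exhibits the sequence `p` of length `n`, i.e. `p` is a block of
consecutive entries of `r`. -/
def Exhibits {Y : Type*} {m n : ℕ} (r : Fin m → Y) (p : Fin n → Y) : Prop :=
  ∃ (k : ℕ) (hk : k + n ≤ m), ∀ i : Fin n, r ⟨k + i, by omega⟩ = p i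

/-- A set of sequences exhibits `p` if one of its members does. -/
def SetExhibits {Y : Type*} {m n : ℕ} (S : Set (Fin m → Y)) (p : Fin n → Y) : Prop :=
  ∃ s ∈ S, Exhibits s p

/-! ### Transition systems and their finite external behaviours -/

/-- Transition systems with outputs in `Y`. -/
structure TransitionSystem (Y : Type*) where
  State : Type*
  init : Set State
  trans : State → State → Prop
  out : State → Y

/-- External behaviours of length `H` of `S` starting from the state `x`: the output sequences of
the runs with `H` states that start in `x`. -/
def TransitionSystem.behavFrom {Y : Type*} (S : TransitionSystem Y) (H : ℕ) (x : S.State) :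
    Set (Fin H → Y) :=
  {y | ∃ r : Fin H → S.State,
      (∀ h0 : 0 < H, r ⟨0, h0⟩ = x) ∧
      (∀ (i : ℕ) (hi : i + 1 < H), S.trans (r ⟨i, by omega⟩) (r ⟨i + 1, hi⟩)) ∧
      ∀ i : Fin H, y i = S.out (r i)}

/-- External behaviours of length `H` of `S`, starting from any initial state. -/
def TransitionSystem.behav {Y : Type*} (S : TransitionSystem Y) (H : ℕ) : Set (Fin H → Y) :=
  {y | ∃ x ∈ S.init, y ∈ S.behavFrom H x}

/-! ### The concrete system -/

/-- A deterministic discrete-time system `x⁺ = f x`, `y = h x` on a domain `D ⊆ ℝⁿ`. From the time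
at which the state leaves `D`, the output is `yExit` forever. -/
structure DynSystem (n : ℕ) (Y : Type*) where
  D : Set (EuclideanSpace ℝ (Fin n))
  f : D → EuclideanSpace ℝ (Fin n)
  h : D → Y
  yExit : Y

open Classical in
/-- One step of the dynamics; `none` means that the state has left the domain. -/
noncomputable def DynSystem.step {n : ℕ} {Y : Type*} (Sys : DynSystem n Y) :
    Option Sys.D → Option Sys.D
  | none => none
  | some x => if hx : Sys.f x ∈ Sys.D then some ⟨Sys.f x, hx⟩ else none

/-- The output of the (possibly exited) state. -/
def DynSystem.output {n : ℕ} {Y : Type*} (Sys : DynSystem n Y) : Option Sys.D → Y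
  | none => Sys.yExit
  | some x => Sys.h x

/-- The embedding of a system as a transition system. If `f` maps `D` into `D`, the additional
absorbing state `none` is unreachable. -/
noncomputable def DynSystem.embed {n : ℕ} {Y : Type*} (Sys : DynSystem n Y) :
    TransitionSystem Y where
  State := Option Sys.D
  init := Set.range some
  trans := fun a b => b = Sys.step a
  out := Sys.output

/-- The set of `H`-long behaviours of the system initialised at `x` (a singleton, as the system
is deterministic). -/
noncomputable def DynSystem.behavAt {n : ℕ} {Y : Type*} (Sys : DynSystem n Y) (H : ℕ)
    (x : Sys.D) : Set (Fin H → Y) :=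
  Sys.embed.behavFrom H (some x)

/-! ### The data-driven abstraction -/

/-- The `ℓ`-sequences witnessed in the `H`-long trajectories started at the sampled states `ω i`,
`i ∈ I`. -/
def observed {n : ℕ} {Y : Type*} (Sys : DynSystem n Y) (ℓ H : ℕ) {N : ℕ} (ω : Fin N → Sys.D)
    (I : Finset (Fin N)) : Set (Fin ℓ → Y) :=
  {w | ∃ i ∈ I, SetExhibits (Sys.behavAt H (ω i)) w}

/-- The domino rule: `w = kσ` and `w' = σk'` for some letters `k, k'` and some word `σ`. -/
def Domino {Y : Type*} {ℓ : ℕ} (w w' : Fin ℓ → Y) : Prop :=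
  ∀ (i : ℕ) (hi : i + 1 < ℓ), w ⟨i + 1, hi⟩ = w' ⟨i, by omega⟩

/-- One round of domino completion: for every blocking state `kσ` of `X` all words `σk'` are
added. -/
def dominoStep {Y : Type*} {ℓ : ℕ} (X : Set (Fin ℓ → Y)) : Set (Fin ℓ → Y) :=
  X ∪ {w' | ∃ w ∈ X, (∀ v ∈ X, ¬ Domino w v) ∧ Domino w w'}

/-- Domino completion: the rounds are repeated until no state is blocking. In particular a
set of words without blocking states is left unchanged. -/
def dominoCompletion {Y : Type*} {ℓ : ℕ} (X : Set (Fin ℓ → Y)) : Set (Fin ℓ → Y) :=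
  ⋃ j : ℕ, dominoStep^[j] X

/-- The `ℓ`-complete transition system built from a set `X` of `ℓ`-sequences: states are the words
of the domino completion of `X`, initial states the words of `X`, transitions follow the domino
rule, and the output of a word is its first letter. -/
def completeAbstraction {Y : Type*} {ℓ : ℕ} (hℓ : 1 ≤ ℓ) (X : Set (Fin ℓ → Y)) :
    TransitionSystem Y where
  State := {w : Fin ℓ → Y // w ∈ dominoCompletion X}
  init := {w | w.1 ∈ X}
  trans := fun w w' => Domino w.1 w'.1
  out := fun w => w.1 ⟨0, by omega⟩

/-- The data-driven `ℓ`-complete abstraction obtained from the sampled initial states `ω`. -/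
def dataAbstraction {n : ℕ} {Y : Type*} (Sys : DynSystem n Y) {ℓ : ℕ} (hℓ : 1 ≤ ℓ) (H : ℕ)
    {N : ℕ} (ω : Fin N → Sys.D) : TransitionSystem Y :=
  completeAbstraction hℓ (observed Sys ℓ H ω Finset.univ)

/-- The complexity: the least number of the sampled trajectories that yield the same set of
observed `ℓ`-sequences as all of them. -/
noncomputable def complexity {n : ℕ} {Y : Type*} (Sys : DynSystem n Y) (ℓ H : ℕ) {N : ℕ}
    (ω : Fin N → Sys.D) : ℕ :=
  sInf {m | ∃ I : Finset (Fin N), I.card = m ∧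
    observed Sys ℓ H ω I = observed Sys ℓ H ω Finset.univ}

/-! ### The scenario bound -/

/-- The polynomial of scenario theory whose root in `(0, 1)` is the risk bound at complexity
`k < N`. -/
noncomputable def scenarioPoly (k N : ℕ) (β e : ℝ) : ℝ :=
  (N.choose k : ℝ) * (1 - e) ^ (N - k)
    - β / N * ∑ m ∈ Finset.Ico k N, (m.choose k : ℝ) * (1 - e) ^ (m - k)

theorem existsUnique_scenarioPoly_root {k N : ℕ} (hk : k < N) {β : ℝ} (hβ0 : 0 < β)
    (hβ1 : β < 1) : ∃! e : ℝ, e ∈ Set.Ioo (0 : ℝ) 1 ∧ scenarioPoly k N β e = 0 := by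
  have hN : (0 : ℝ) < N := by exact_mod_cast (by omega : 0 < N)
  have hC : (0 : ℝ) < (N.choose k : ℝ) := by exact_mod_cast Nat.choose_pos hk.le
  have hcont : Continuous (scenarioPoly k N β) := by unfold scenarioPoly; fun_prop
  have h0 : 0 < scenarioPoly k N β 0 := by
    have hle : ∑ m ∈ Finset.Ico k N, (m.choose k : ℝ) * (1 - 0) ^ (m - k)
        ≤ N * (N.choose k : ℝ) := by
      calc ∑ m ∈ Finset.Ico k N, (m.choose k : ℝ) * (1 - 0) ^ (m - k)
          ≤ ∑ m ∈ Finset.Ico k N, (N.choose k : ℝ) := by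
            refine Finset.sum_le_sum fun m hm => ?_
            have := Nat.choose_le_choose k (Finset.mem_Ico.1 hm).2.le
            simpa using this
        _ = ((N - k : ℕ) : ℝ) * (N.choose k : ℝ) := by simp
        _ ≤ N * (N.choose k : ℝ) := by
            have : ((N - k : ℕ) : ℝ) ≤ N := by exact_mod_cast Nat.sub_le N k
            gcongr
    have h2 : β / N * ∑ m ∈ Finset.Ico k N, (m.choose k : ℝ) * (1 - 0) ^ (m - k)
        ≤ β * (N.choose k : ℝ) := by
      calc _ ≤ β / N * (N * (N.choose k : ℝ)) := by gcongr
        _ = β * (N.choose k : ℝ) := by field_simp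
    have h3 : β * (N.choose k : ℝ) < (N.choose k : ℝ) := by nlinarith
    unfold scenarioPoly
    simp only [sub_zero, one_pow, mul_one] at h2 ⊢
    linarith
  have h1 : scenarioPoly k N β 1 < 0 := by
    have hs : ∑ m ∈ Finset.Ico k N, (m.choose k : ℝ) * (1 - 1 : ℝ) ^ (m - k) = 1 := by
      rw [Finset.sum_eq_single_of_mem k (by simp [hk])]
      · simp
      · intro m hm hne
        have : m - k ≠ 0 := by have := (Finset.mem_Ico.1 hm).1; omega
        simp [this]
    unfold scenarioPoly
    rw [hs]
    have : N - k ≠ 0 := by omega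
    have hb : 0 < β / N := by positivity
    simp [this]
    exact hb
  obtain ⟨e, he, he0⟩ := intermediate_value_Ioo' (zero_le_one (α := ℝ)) hcont.continuousOn
    (show (0 : ℝ) ∈ Set.Ioo (scenarioPoly k N β 1) (scenarioPoly k N β 0) from ⟨h1, h0⟩)
  have key : ∀ a b : ℝ, a < b → a ∈ Set.Ioo (0 : ℝ) 1 → b ∈ Set.Ioo (0 : ℝ) 1 →
      scenarioPoly k N β a = 0 → scenarioPoly k N β b = 0 → False := by
    intro a b hab ha hb hpa hpb
    unfold scenarioPoly at hpa hpb
    have hs0 : (0 : ℝ) < 1 - b := by linarith [hb.2]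
    have hst : 1 - b < 1 - a := by linarith
    generalize 1 - a = t at *
    generalize 1 - b = s at *
    have ht0 : 0 < t := hs0.trans hst
    have hlt : (∑ m ∈ Finset.Ico k N, (m.choose k : ℝ) * t ^ (m - k)) * s ^ (N - k)
        < (∑ m ∈ Finset.Ico k N, (m.choose k : ℝ) * s ^ (m - k)) * t ^ (N - k) := by
      rw [Finset.sum_mul, Finset.sum_mul]
      refine Finset.sum_lt_sum_of_nonempty ⟨k, by simp [hk]⟩ fun m hm => ?_
      obtain ⟨hm1, hm2⟩ := Finset.mem_Ico.1 hm
      have hc : (0 : ℝ) < (m.choose k : ℝ) := by exact_mod_cast Nat.choose_pos hm1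
      have hp : s ^ (N - m) < t ^ (N - m) := pow_lt_pow_left₀ hst hs0.le (by omega)
      have hsplit : N - k = (m - k) + (N - m) := by omega
      rw [hsplit, pow_add, pow_add]
      have hpos : 0 < (m.choose k : ℝ) * t ^ (m - k) * s ^ (m - k) := by positivity
      nlinarith
    have hb' : 0 < β / N := by positivity
    have e1 : (N.choose k : ℝ) * t ^ (N - k)
        = β / N * ∑ m ∈ Finset.Ico k N, (m.choose k : ℝ) * t ^ (m - k) := by linarith
    have e2 : (N.choose k : ℝ) * s ^ (N - k)
        = β / N * ∑ m ∈ Finset.Ico k N, (m.choose k : ℝ) * s ^ (m - k) := by linarith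
    have h3 := mul_lt_mul_of_pos_left hlt hb'
    rw [← mul_assoc, ← mul_assoc, ← e1, ← e2] at h3
    nlinarith
  refine ⟨e, ⟨he, he0⟩, fun e' ⟨he', he0'⟩ => ?_⟩
  rcases lt_trichotomy e' e with h | h | h
  · exact (key e' e h he' he he0' he0).elim
  · exact h
  · exact (key e e' h he he' he0 he0').elim

open Classical in
/-- The scenario bound `ε(k, N, β)`: for `k < N` and `β ∈ (0, 1)` the unique `e ∈ (0, 1)` with
`C(N,k) (1 - e)^(N-k) = (β / N) ∑_{m=k}^{N-1} C(m,k) (1 - e)^(m-k)`, and `1` otherwise. -/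
noncomputable def scenarioEps (k N : ℕ) (β : ℝ) : ℝ :=
  if h : k < N ∧ 0 < β ∧ β < 1 then
    (existsUnique_scenarioPoly_root h.1 h.2.1 h.2.2).choose
  else 1

/-! Only the output trajectory matters, and it takes values in the finite set `Fin H → Y`, so the
claim concerns i.i.d. samples of letters `a` carrying weights `q a` and sets `L a` of `ℓ`-blocks.
The observed words are the coverage of the sample and the complexity is its cover number. A
trajectory all of whose blocks were observed is a behaviour of the abstraction
(`mem_behav_completeAbstraction`), so it suffices to bound the weight of the letters covered by the
sample.

Fix a cover number `k` and a coverage `S`; let `w m` be the probability that a sample of size `m`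
has both, and `v` the weight of the letters with `L a ⊆ S`. Deleting any of the `m + 1 - k` entries
outside a smallest cover preserves `k` and `S`, whence `(m + 1 - k) * w (m + 1) ≤ (m + 1) * v * w m`
(`coverWeight_succ_le`): `w m / m.choose k` decays at least geometrically with ratio `v`. If `v < 1
- scenarioEps k N β`, the sign of the scenario polynomial at `1 - v` turns this into `w N ≤ β / N *
∑ m ∈ Finset.Ico k N, w m`. Summed over `k` and `S`, each of the `N` sizes `m < N` has total mass
one, so violations have probability at most `β`. -/

/-! ### Finite samples and the size of their smallest covers -/

section Sampling

variable {Z W : Type*}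

/-- The union of the sets attached to the entries of `z` with index in `I`. -/
def coverage (L : Z → Set W) {m : ℕ} (z : Fin m → Z) (I : Finset (Fin m)) : Set W :=
  {w | ∃ i ∈ I, w ∈ L (z i)}

/-- The least number of entries of `z` with the same coverage as all of them. -/
noncomputable def coverNumber (L : Z → Set W) {m : ℕ} (z : Fin m → Z) : ℕ :=
  sInf {c | ∃ I : Finset (Fin m), I.card = c ∧ coverage L z I = coverage L z Finset.univ}

theorem exists_card_eq_coverNumber (L : Z → Set W) {m : ℕ} (z : Fin m → Z) :
    ∃ I : Finset (Fin m), I.card = coverNumber L z ∧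
      coverage L z I = coverage L z Finset.univ :=
  Nat.sInf_mem (s := {c | ∃ I : Finset (Fin m), I.card = c ∧
    coverage L z I = coverage L z Finset.univ}) ⟨_, Finset.univ, rfl, rfl⟩

theorem coverNumber_le_card {L : Z → Set W} {m : ℕ} {z : Fin m → Z} {I : Finset (Fin m)}
    (h : coverage L z I = coverage L z Finset.univ) : coverNumber L z ≤ I.card :=
  Nat.sInf_le ⟨I, rfl, h⟩

theorem coverNumber_le (L : Z → Set W) {m : ℕ} (z : Fin m → Z) : coverNumber L z ≤ m := by
  simpa using coverNumber_le_card (L := L) (z := z) (I := Finset.univ) rfl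

theorem coverage_mono (L : Z → Set W) {m : ℕ} (z : Fin m → Z) {I J : Finset (Fin m)}
    (h : I ⊆ J) : coverage L z I ⊆ coverage L z J :=
  fun _ ⟨i, hi, hw⟩ => ⟨i, h hi, hw⟩

theorem coverage_map_succAbove (L : Z → Set W) {m : ℕ} (z : Fin (m + 1) → Z) (j : Fin (m + 1))
    (J : Finset (Fin m)) :
    coverage L z (J.map j.succAboveEmb) = coverage L (j.removeNth z) J := by
  ext w
  simp [coverage, Fin.removeNth]

/-- Deleting an entry outside a smallest cover changes neither the coverage nor the cover number. -/
theorem removeNth_of_notMem_cover {L : Z → Set W} {m : ℕ} {z : Fin (m + 1) → Z}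
    {I : Finset (Fin (m + 1))} (hcard : I.card = coverNumber L z)
    (hI : coverage L z I = coverage L z Finset.univ) {j : Fin (m + 1)} (hj : j ∉ I) :
    coverNumber L (j.removeNth z) = coverNumber L z ∧
      coverage L (j.removeNth z) Finset.univ = coverage L z Finset.univ := by
  obtain ⟨J, rfl⟩ : ∃ J : Finset (Fin m), J.map j.succAboveEmb = I := by
    refine ⟨Finset.univ.filter fun i => j.succAbove i ∈ I, ?_⟩
    ext i
    simp only [Finset.mem_map, Finset.mem_filter, Finset.mem_univ, true_and,
      Fin.coe_succAboveEmb]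
    constructor
    · rintro ⟨a, ha, rfl⟩
      exact ha
    · intro hi
      have hne : i ≠ j := fun h => hj (h ▸ hi)
      obtain ⟨a, rfl⟩ := Fin.exists_succAbove_eq hne
      exact ⟨a, hi, rfl⟩
  rw [coverage_map_succAbove] at hI
  have huniv : coverage L (j.removeNth z) Finset.univ = coverage L z Finset.univ := by
    apply subset_antisymm
    · rw [← coverage_map_succAbove]
      exact coverage_mono L z (Finset.subset_univ _)
    · rw [← hI]
      exact coverage_mono L _ (Finset.subset_univ _)
  refine ⟨le_antisymm ?_ ?_, huniv⟩
  · rw [← hcard, Finset.card_map]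
    exact coverNumber_le_card (hI.trans huniv.symm)
  -- Conversely, a smallest cover of the shortened sample, reindexed, covers all of `z`.
  · obtain ⟨K, hK, hK'⟩ := exists_card_eq_coverNumber L (j.removeNth z)
    rw [← hK, ← Finset.card_map j.succAboveEmb]
    apply coverNumber_le_card
    rw [coverage_map_succAbove, hK', huniv]

/-! ### Product weights and their recursion in the sample size -/

variable [Fintype Z]

open Classical in
/-- The weight of the letters whose set is contained in `S`. -/
noncomputable def coveredWeight (L : Z → Set W) (q : Z → ℝ) (S : Set W) : ℝ :=
  ∑ a, if L a ⊆ S then q a else 0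

open Classical in
/-- The product weight of the samples of size `m` with cover number `k` and coverage `S`. -/
noncomputable def coverWeight (L : Z → Set W) (q : Z → ℝ) (m k : ℕ) (S : Set W) : ℝ :=
  ∑ z : Fin m → Z,
    if coverNumber L z = k ∧ coverage L z Finset.univ = S then ∏ i, q (z i) else 0

theorem coverWeight_nonneg (L : Z → Set W) {q : Z → ℝ} (hq : ∀ a, 0 ≤ q a) (m k : ℕ)
    (S : Set W) : 0 ≤ coverWeight L q m k S := by
  refine Finset.sum_nonneg fun z _ => ?_
  split_ifs
  · exact Finset.prod_nonneg fun i _ => hq _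
  · exact le_rfl

theorem coveredWeight_nonneg (L : Z → Set W) {q : Z → ℝ} (hq : ∀ a, 0 ≤ q a) (S : Set W) :
    0 ≤ coveredWeight L q S := by
  refine Finset.sum_nonneg fun z _ => ?_
  split_ifs
  · exact hq _
  · exact le_rfl

/-- Double counting of pairs of a sample and a deleted position: each sample on the left admits at
least `m + 1 - k` deletions preserving `k` and `S`, and every deleted letter has its set inside `S`.
-/
theorem coverWeight_succ_le (L : Z → Set W) {q : Z → ℝ} (hq : ∀ a, 0 ≤ q a) {m k : ℕ}
    (hk : k ≤ m) (S : Set W) :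
    ((m : ℝ) + 1 - k) * coverWeight L q (m + 1) k S
      ≤ (m + 1) * (coveredWeight L q S * coverWeight L q m k S) := by
  classical
  have hdel : ∀ z : Fin (m + 1) → Z,
      ((m : ℝ) + 1 - k) *
          (if coverNumber L z = k ∧ coverage L z Finset.univ = S then ∏ i, q (z i) else 0)
        ≤ ∑ j : Fin (m + 1), (if L (z j) ⊆ S then q (z j) else 0) *
          (if coverNumber L (j.removeNth z) = k ∧ coverage L (j.removeNth z) Finset.univ = S
            then ∏ i, q (j.removeNth z i) else 0) := by
    intro z
    have hterm : ∀ j : Fin (m + 1), 0 ≤ (if L (z j) ⊆ S then q (z j) else 0) *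
          (if coverNumber L (j.removeNth z) = k ∧ coverage L (j.removeNth z) Finset.univ = S
            then ∏ i, q (j.removeNth z i) else 0) := by
      intro j
      apply mul_nonneg <;> split_ifs
      · exact hq _
      · exact le_rfl
      · exact Finset.prod_nonneg fun i _ => hq _
      · exact le_rfl
    split_ifs with h
    · obtain ⟨rfl, rfl⟩ := h
      obtain ⟨I, hcard, hI⟩ := exists_card_eq_coverNumber L z
      have hsub : ∑ j ∈ Iᶜ, ∏ i, q (z i) ≤
          ∑ j ∈ Iᶜ, (if L (z j) ⊆ coverage L z Finset.univ then q (z j) else 0) *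
          (if coverNumber L (j.removeNth z) = coverNumber L z ∧
              coverage L (j.removeNth z) Finset.univ = coverage L z Finset.univ
            then ∏ i, q (j.removeNth z i) else 0) := by
        refine Finset.sum_le_sum fun j hj => ?_
        have hj' : L (z j) ⊆ coverage L z Finset.univ := fun w hw => ⟨j, Finset.mem_univ j, hw⟩
        rw [if_pos hj', if_pos (removeNth_of_notMem_cover hcard hI (Finset.mem_compl.1 hj)),
          Fin.prod_univ_succAbove _ j]
        rfl
      refine le_trans (le_of_eq ?_) (hsub.trans
        (Finset.sum_le_sum_of_subset_of_nonneg (Finset.subset_univ _) fun j _ _ => hterm j))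
      rw [Finset.sum_const, nsmul_eq_mul, Finset.card_compl, Fintype.card_fin, hcard,
        Nat.cast_sub (by omega)]
      push_cast
      rfl
    · rw [mul_zero]
      exact Finset.sum_nonneg fun j _ => hterm j
  calc ((m : ℝ) + 1 - k) * coverWeight L q (m + 1) k S
      ≤ ∑ z : Fin (m + 1) → Z, ∑ j : Fin (m + 1), (if L (z j) ⊆ S then q (z j) else 0) *
          (if coverNumber L (j.removeNth z) = k ∧ coverage L (j.removeNth z) Finset.univ = S
            then ∏ i, q (j.removeNth z i) else 0) := by
        rw [coverWeight, Finset.mul_sum]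
        exact Finset.sum_le_sum fun z _ => hdel z
    _ = ∑ j : Fin (m + 1), coveredWeight L q S * coverWeight L q m k S := by
        rw [Finset.sum_comm]
        refine Finset.sum_congr rfl fun j _ => ?_
        -- Splitting off entry `j` factorises the sum, with the same value for every `j`.
        rw [← (Fin.insertNthEquiv (fun _ => Z) j).sum_comp, Fintype.sum_prod_type, coveredWeight,
          coverWeight, Finset.sum_mul_sum]
        simp [Fin.insertNthEquiv]
    _ = _ := by simp

theorem sum_prod_eq_one {q : Z → ℝ} (hq1 : ∑ a, q a = 1) (m : ℕ) :
    ∑ z : Fin m → Z, ∏ i, q (z i) = 1 := by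
  classical
  rw [← Fintype.prod_sum]
  simp [hq1]

theorem sum_coverWeight [Fintype (Set W)] (L : Z → Set W) {q : Z → ℝ}
    (hq1 : ∑ a, q a = 1) (m : ℕ) :
    ∑ k ∈ Finset.range (m + 1), ∑ S : Set W, coverWeight L q m k S = 1 := by
  classical
  rw [← sum_prod_eq_one hq1 m]
  simp only [coverWeight]
  rw [Finset.sum_congr rfl fun k _ => Finset.sum_comm, Finset.sum_comm]
  refine Finset.sum_congr rfl fun z _ => ?_
  have h1 : coverNumber L z < m + 1 := Nat.lt_succ_of_le (coverNumber_le L z)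
  simp [ite_and, h1]

end Sampling

/-! ### The scenario bound -/

theorem scenarioEps_of_le {k N : ℕ} (h : N ≤ k) (β : ℝ) : scenarioEps k N β = 1 :=
  dif_neg fun h' => absurd h'.1 (by omega)

/-- A positive value to the right of the root would, by the intermediate value theorem, force a
second root, since the value at `1` is negative. -/
theorem scenarioPoly_nonpos {k N : ℕ} (hk : k < N) {β : ℝ} (hβ0 : 0 < β) (hβ1 : β < 1) {e : ℝ}
    (he : scenarioEps k N β < e) (he1 : e ≤ 1) : scenarioPoly k N β e ≤ 0 := by
  have hex := existsUnique_scenarioPoly_root hk hβ0 hβ1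
  have hdef : scenarioEps k N β = hex.choose := dif_pos ⟨hk, hβ0, hβ1⟩
  obtain ⟨⟨hroot, -⟩, huniq⟩ := hex.choose_spec
  rw [← hdef] at hroot huniq
  have h1 : scenarioPoly k N β 1 ≤ 0 := by
    have : N - k ≠ 0 := by omega
    simp only [scenarioPoly, sub_self, zero_pow this, mul_zero, zero_sub, neg_nonpos]
    positivity
  by_contra! hpos
  have hcont : Continuous (scenarioPoly k N β) := by unfold scenarioPoly; fun_prop
  obtain ⟨x, hx, hx0⟩ := intermediate_value_Icc' he1 hcont.continuousOn ⟨h1, hpos.le⟩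
  -- At `1` the term `m = k` survives because `0 ^ 0 = 1`, which makes the value strictly negative.
  have hx1 : x ≠ 1 := by
    rintro rfl
    have hs : ∑ m ∈ Finset.Ico k N, (m.choose k : ℝ) * (1 - 1 : ℝ) ^ (m - k) ≥ 1 := by
      have := Finset.single_le_sum (f := fun m => (m.choose k : ℝ) * (1 - 1 : ℝ) ^ (m - k))
        (fun m _ => by simp only [sub_self]; positivity) (Finset.mem_Ico.2 ⟨le_rfl, hk⟩)
      simpa using this
    have hNk : N - k ≠ 0 := by omega
    have hb : 0 < β / N := div_pos hβ0 (by exact_mod_cast (by omega : 0 < N))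
    have : scenarioPoly k N β 1 < 0 := by
      rw [scenarioPoly, sub_self, zero_pow hNk]
      rw [sub_self] at hs
      nlinarith
    exact this.ne hx0
  have := huniq x ⟨⟨hroot.1.trans (he.trans_le hx.1), lt_of_le_of_ne hx.2 hx1⟩, hx0⟩
  linarith [hx.1]

/-- Weights `a m` that decay at least geometrically with a ratio `t < 1 - scenarioEps k N β`. -/
theorem choose_mul_le_of_geometric {k N : ℕ} (hk : k < N) {β : ℝ} (hβ0 : 0 < β) (hβ1 : β < 1)
    {t : ℝ} (ht0 : 0 ≤ t) (ht : t < 1 - scenarioEps k N β) {a : ℕ → ℝ} (ha : ∀ m, 0 ≤ a m)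
    (hstep : ∀ m, k ≤ m → a (m + 1) ≤ t * a m) :
    (N.choose k : ℝ) * a N ≤ β / N * ∑ m ∈ Finset.Ico k N, (m.choose k : ℝ) * a m := by
  have hb : 0 ≤ β / N := by positivity
  have hpow : ∀ m d, k ≤ m → a (m + d) ≤ t ^ d * a m := by
    intro m d hm
    induction d with
    | zero => simp
    | succ d ih =>
      calc a (m + (d + 1)) ≤ t * a (m + d) := hstep (m + d) (by omega)
        _ ≤ t * (t ^ d * a m) := by gcongr
        _ = t ^ (d + 1) * a m := by ring
  have hpoly := scenarioPoly_nonpos hk hβ0 hβ1 (e := 1 - t) (by linarith) (by linarith)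
  rw [scenarioPoly, sub_sub_cancel] at hpoly
  -- The main case divides by `t ^ (N - k)`; for `t = 0` the decay already forces `a N = 0`, as `k <
  -- N`.
  rcases ht0.eq_or_lt with rfl | htpos
  · have h0 : a N ≤ 0 := by
      have := hpow k (N - k) le_rfl
      rwa [Nat.add_sub_cancel' hk.le, zero_pow (by omega), zero_mul] at this
    rw [le_antisymm h0 (ha N), mul_zero]
    exact mul_nonneg hb (Finset.sum_nonneg fun m _ => mul_nonneg (by positivity) (ha m))
  · have hsum : (∑ m ∈ Finset.Ico k N, (m.choose k : ℝ) * t ^ (m - k)) * a N ≤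
        t ^ (N - k) * ∑ m ∈ Finset.Ico k N, (m.choose k : ℝ) * a m := by
      rw [Finset.sum_mul, Finset.mul_sum]
      refine Finset.sum_le_sum fun m hm => ?_
      obtain ⟨hm1, hm2⟩ := Finset.mem_Ico.1 hm
      have h := hpow m (N - m) hm1
      rw [Nat.add_sub_cancel' hm2.le] at h
      calc (m.choose k : ℝ) * t ^ (m - k) * a N
          ≤ (m.choose k : ℝ) * t ^ (m - k) * (t ^ (N - m) * a m) := by gcongr
        _ = t ^ (N - k) * ((m.choose k : ℝ) * a m) := by
          rw [show N - k = (m - k) + (N - m) by omega, pow_add]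
          ring
    refine le_of_mul_le_mul_left ?_ (pow_pos htpos (N - k))
    calc t ^ (N - k) * ((N.choose k : ℝ) * a N)
        = (N.choose k : ℝ) * t ^ (N - k) * a N := by ring
      _ ≤ (β / N * ∑ m ∈ Finset.Ico k N, (m.choose k : ℝ) * t ^ (m - k)) * a N := by
        exact mul_le_mul_of_nonneg_right (by linarith) (ha N)
      _ = β / N * ((∑ m ∈ Finset.Ico k N, (m.choose k : ℝ) * t ^ (m - k)) * a N) := by ring
      _ ≤ β / N * (t ^ (N - k) * ∑ m ∈ Finset.Ico k N, (m.choose k : ℝ) * a m) := by gcongr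
      _ = _ := by ring

/-- Dividing by `m.choose k` absorbs the factor `(m + 1) / (m + 1 - k)` of the recursion, leaving
pure geometric decay. -/
theorem coverWeight_le_of_coveredWeight_lt {Z W : Type*} [Fintype Z] (L : Z → Set W)
    {q : Z → ℝ} (hq : ∀ a, 0 ≤ q a) {k N : ℕ} (hk : k < N) {β : ℝ} (hβ0 : 0 < β) (hβ1 : β < 1)
    {S : Set W} (hS : coveredWeight L q S < 1 - scenarioEps k N β) :
    coverWeight L q N k S ≤ β / N * ∑ m ∈ Finset.Ico k N, coverWeight L q m k S := by
  have hcancel : ∀ m, k ≤ m →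
      (m.choose k : ℝ) * (coverWeight L q m k S / m.choose k) = coverWeight L q m k S :=
    fun m hm => mul_div_cancel₀ _ (by exact_mod_cast (Nat.choose_pos hm).ne')
  have h := choose_mul_le_of_geometric hk hβ0 hβ1 (coveredWeight_nonneg L hq S) hS
    (a := fun m => coverWeight L q m k S / m.choose k)
    (fun m => div_nonneg (coverWeight_nonneg L hq m k S) (Nat.cast_nonneg _)) ?_
  · rw [hcancel N hk.le,
      Finset.sum_congr rfl fun m hm => hcancel m (Finset.mem_Ico.1 hm).1] at h
    exact h
  · intro m hm
    have hc : (0 : ℝ) < m.choose k := by exact_mod_cast Nat.choose_pos hm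
    have hc' : (0 : ℝ) < (m + 1).choose k := by exact_mod_cast Nat.choose_pos (by omega)
    have hkm : (k : ℝ) ≤ m := by exact_mod_cast hm
    have hid : ((m + 1).choose k : ℝ) * ((m : ℝ) + 1 - k) = (m.choose k : ℝ) * (m + 1) := by
      have h1 := Nat.choose_mul_succ_eq m k
      have h2 : ((m + 1 - k : ℕ) : ℝ) = (m : ℝ) + 1 - k := by
        rw [Nat.cast_sub (by omega)]
        push_cast
        rfl
      rw [← h2]
      exact_mod_cast h1.symm
    have hrec := coverWeight_succ_le L hq hm S
    rw [div_le_iff₀ hc', mul_div_assoc', div_mul_eq_mul_div, le_div_iff₀ hc]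
    refine le_of_mul_le_mul_left ?_ (show (0 : ℝ) < (m : ℝ) + 1 - k by linarith)
    calc ((m : ℝ) + 1 - k) * (coverWeight L q (m + 1) k S * m.choose k)
        = ((m : ℝ) + 1 - k) * coverWeight L q (m + 1) k S * m.choose k := by ring
      _ ≤ (m + 1) * (coveredWeight L q S * coverWeight L q m k S) * m.choose k := by gcongr
      _ = coveredWeight L q S * coverWeight L q m k S * (m.choose k * (m + 1)) := by ring
      _ = _ := by rw [← hid]; ring

open Classical in
/-- The samples whose coverage violates the scenario bound have weight at most `β`. -/
theorem sum_prod_violation_le {Z W : Type*} [Fintype Z] [Finite W] (L : Z → Set W)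
    {q : Z → ℝ} (hq : ∀ a, 0 ≤ q a) (hq1 : ∑ a, q a = 1) {N : ℕ} (hN : 1 ≤ N) {β : ℝ}
    (hβ0 : 0 < β) (hβ1 : β < 1) :
    ∑ z : Fin N → Z, (if coveredWeight L q (coverage L z Finset.univ) <
      1 - scenarioEps (coverNumber L z) N β then ∏ i, q (z i) else 0) ≤ β := by
  have : Fintype (Set W) := Fintype.ofFinite _
  have hb : 0 ≤ β / N := by positivity
  have hN0 : (N : ℝ) ≠ 0 := by exact_mod_cast (by omega : N ≠ 0)
  have hnn := coverWeight_nonneg L hq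
  calc _ = ∑ k ∈ Finset.range (N + 1), ∑ S : Set W,
        (if coveredWeight L q S < 1 - scenarioEps k N β then coverWeight L q N k S else 0) := by
        have hpush : ∀ (k : ℕ) (S : Set W),
            (if coveredWeight L q S < 1 - scenarioEps k N β then coverWeight L q N k S else 0) =
            ∑ z : Fin N → Z, if coverNumber L z = k then
              (if coverage L z Finset.univ = S then
                (if coveredWeight L q S < 1 - scenarioEps k N β then ∏ i, q (z i) else 0)
                else 0) else 0 := by
          intro k S
          split_ifs with h
          · simp only [coverWeight, ite_and]
          · simp
        simp only [hpush]
        rw [Finset.sum_congr rfl fun k _ => Finset.sum_comm, Finset.sum_comm]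
        refine Finset.sum_congr rfl fun z _ => ?_
        have h1 : coverNumber L z < N + 1 := Nat.lt_succ_of_le (coverNumber_le L z)
        rw [Finset.sum_eq_single_of_mem _ (Finset.mem_range.2 h1) fun k _ hk => by
          simp [Ne.symm hk]]
        simp
    _ ≤ ∑ k ∈ Finset.range N, ∑ S : Set W,
        β / N * ∑ m ∈ Finset.Ico k N, coverWeight L q m k S := by
        rw [Finset.sum_range_succ]
        -- Full complexity `k = N` cannot violate the bound, because there `scenarioEps` is `1`.
        have hlast : ∑ S : Set W, (if coveredWeight L q S < 1 - scenarioEps N N β then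
            coverWeight L q N N S else 0) = 0 := by
          refine Finset.sum_eq_zero fun S _ => if_neg ?_
          rw [scenarioEps_of_le le_rfl, sub_self]
          exact (coveredWeight_nonneg L hq S).not_gt
        rw [hlast, add_zero]
        refine Finset.sum_le_sum fun k hk => Finset.sum_le_sum fun S _ => ?_
        split_ifs with h
        · exact coverWeight_le_of_coveredWeight_lt L hq (Finset.mem_range.1 hk) hβ0 hβ1 h
        · exact mul_nonneg hb (Finset.sum_nonneg fun m _ => hnn m k S)
    _ = β / N * ∑ m ∈ Finset.range N, ∑ k ∈ Finset.range (m + 1), ∑ S : Set W,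
          coverWeight L q m k S := by
        simp only [← Finset.mul_sum]
        congr 1
        rw [Finset.sum_congr rfl fun k _ => Finset.sum_comm]
        refine Finset.sum_comm' fun k m => ?_
        simp only [Finset.mem_range, Finset.mem_Ico]
        omega
    _ = β := by
        -- Each of the `N` sample sizes contributes mass one, cancelling the `N` in `β / N`.
        rw [Finset.sum_congr rfl fun m _ => sum_coverWeight L hq1 m]
        simp [hN0]

/-! ### Domino completion and behaviours of the abstraction -/

theorem iterate_dominoStep_subset {Y : Type*} {ℓ : ℕ} (X : Set (Fin ℓ → Y)) (j : ℕ) :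
    dominoStep^[j] X ⊆ dominoCompletion X :=
  Set.subset_iUnion (fun j => dominoStep^[j] X) j

theorem exists_domino_of_mem_dominoCompletion {Y : Type*} {ℓ : ℕ} (hℓ : 1 ≤ ℓ)
    {X : Set (Fin ℓ → Y)} {w : Fin ℓ → Y} (hw : w ∈ dominoCompletion X) :
    ∃ v ∈ dominoCompletion X, Domino w v := by
  obtain ⟨j, hj⟩ := Set.mem_iUnion.1 hw
  by_cases h : ∃ v ∈ dominoStep^[j] X, Domino w v
  · obtain ⟨v, hv, hd⟩ := h
    exact ⟨v, iterate_dominoStep_subset X j hv, hd⟩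
  · push Not at h
    -- The new last letter is arbitrary; the first letter of `w` serves, as `1 ≤ ℓ`.
    have hd : Domino w fun i : Fin ℓ =>
        if hi : (i : ℕ) + 1 < ℓ then w ⟨i + 1, hi⟩ else w ⟨0, by omega⟩ :=
      fun i hi => by simp [hi]
    refine ⟨_, iterate_dominoStep_subset X (j + 1) ?_, hd⟩
    rw [Function.iterate_succ_apply']
    exact Or.inr ⟨w, hj, h, hd⟩

/-- A word all of whose `ℓ`-blocks belong to `X` is a behaviour of the `ℓ`-complete system built
from `X`. -/
theorem mem_behav_completeAbstraction {Y : Type*} {ℓ H : ℕ} (hℓ : 1 ≤ ℓ) (hH : ℓ ≤ H)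
    {X : Set (Fin ℓ → Y)} {y : Fin H → Y} (hy : {w | Exhibits y w} ⊆ X) :
    y ∈ (completeAbstraction hℓ X).behav H := by
  have hX : X ⊆ dominoCompletion X := iterate_dominoStep_subset X 0
  have hblock : ∀ k, (hk : k + ℓ ≤ H) → (fun i : Fin ℓ => y ⟨k + i, by omega⟩) ∈ X :=
    fun k hk => hy ⟨k, hk, fun _ => rfl⟩
  let T := {w : Fin ℓ → Y // w ∈ dominoCompletion X}
  have hsucc : ∀ q : T, ∃ q' : T, Domino q.1 q'.1 := fun q => by
    obtain ⟨v, hv, hd⟩ := exists_domino_of_mem_dominoCompletion hℓ q.2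
    exact ⟨⟨v, hv⟩, hd⟩
  choose nxt hnxt using hsucc
  -- The run follows the blocks of `y` up to the final one, `last`, then takes arbitrary successors.
  -- The domino rule shifts `last` left, so the remaining `ℓ - 1` outputs are still letters of `y`.
  let last : T := ⟨_, hX (hblock (H - ℓ) (by omega))⟩
  have hshift : ∀ (j a : ℕ) (h : a + j < ℓ),
      (nxt^[j] last).1 ⟨a, by omega⟩ = last.1 ⟨a + j, h⟩ := by
    intro j
    induction j with
    | zero => intro a h; rfl
    | succ j ih =>
      intro a h
      rw [Function.iterate_succ_apply', ← hnxt (nxt^[j] last) a (by omega), ih (a + 1) (by omega)]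
      exact congrArg last.1 (Fin.ext (show a + 1 + j = a + (j + 1) by omega))
  let r : ℕ → T := fun i =>
    if hi : i + ℓ ≤ H then ⟨_, hX (hblock i hi)⟩ else nxt^[i - (H - ℓ)] last
  have hr0 : (r 0).1 ∈ X := by
    simp only [r, dif_pos (show 0 + ℓ ≤ H by omega)]
    exact hblock 0 (by omega)
  refine ⟨r 0, hr0, fun i => r i, fun _ => rfl, ?_, ?_⟩
  · intro i hi
    change Domino (r i).1 (r (i + 1)).1
    by_cases h1 : i + 1 + ℓ ≤ H
    · simp only [r, dif_pos h1, dif_pos (show i + ℓ ≤ H by omega)]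
      intro a ha
      simp only
      congr 2
      omega
    · by_cases h2 : i + ℓ ≤ H
      · obtain rfl : i = H - ℓ := by omega
        have h3 : H - ℓ + 1 - (H - ℓ) = 1 := by omega
        simp only [r, dif_neg h1, dif_pos h2, h3]
        exact hnxt last
      · have h3 : i + 1 - (H - ℓ) = (i - (H - ℓ)) + 1 := by omega
        simp only [r, dif_neg h1, dif_neg h2, h3, Function.iterate_succ_apply']
        exact hnxt _
  · intro i
    change y i = (r i).1 ⟨0, by omega⟩
    by_cases h : (i : ℕ) + ℓ ≤ H
    · simp [r, dif_pos h]
    · have hi := i.2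
      simp only [r, dif_neg h]
      rw [hshift _ 0 (by omega)]
      simp only [last]
      congr 1
      ext
      simp only
      omega

/-! ### Trajectories of the concrete system -/

/-- The output trajectory of length `H` started at `x`. -/
noncomputable def DynSystem.trajectory {n : ℕ} {Y : Type*} (Sys : DynSystem n Y) (H : ℕ)
    (x : Sys.D) : Fin H → Y :=
  fun i => Sys.output (Sys.step^[i] (some x))

theorem DynSystem.behavAt_eq {n : ℕ} {Y : Type*} (Sys : DynSystem n Y) {H : ℕ}
    (x : Sys.D) : Sys.behavAt H x = {Sys.trajectory H x} := by
  ext y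
  simp only [Set.mem_singleton_iff]
  constructor
  · rintro ⟨r, h0, hstep, hout⟩
    have hr : ∀ (i : ℕ) (hi : i < H), r ⟨i, hi⟩ = Sys.step^[i] (some x) := by
      intro i
      induction i with
      | zero => exact fun hi => h0 hi
      | succ i ih =>
        intro hi
        rw [Function.iterate_succ_apply', ← ih (by omega)]
        exact hstep i hi
    funext i
    rw [hout i, hr i i.2]
    rfl
  · rintro rfl
    refine ⟨fun i => Sys.step^[i] (some x), fun _ => rfl, fun i hi => ?_, fun i => rfl⟩
    exact Function.iterate_succ_apply' _ _ _

theorem DynSystem.measurableSet_output_iterate {n : ℕ} {Y : Type*} (Sys : DynSystem n Y)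
    (hD : MeasurableSet Sys.D) (hf : Measurable Sys.f)
    (hh : ∀ y : Y, MeasurableSet (Sys.h ⁻¹' {y})) (y : Y) (i : ℕ) :
    MeasurableSet {x : Sys.D | Sys.output (Sys.step^[i] (some x)) = y} := by
  induction i with
  | zero => exact hh y
  | succ i ih =>
    have hnone : Sys.step^[i] none = none := Function.iterate_fixed rfl i
    -- The first step is peeled off, not the last: either `f x` stays in `D` and the event for `i`
    -- holds there, or the output is `yExit` from then on.
    have heq : {x : Sys.D | Sys.output (Sys.step^[i + 1] (some x)) = y} =
        Sys.f ⁻¹' (Subtype.val '' {x : Sys.D | Sys.output (Sys.step^[i] (some x)) = y}) ∪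
          (Sys.f ⁻¹' Sys.Dᶜ ∩ {_x | Sys.yExit = y}) := by
      ext x
      by_cases hx : Sys.f x ∈ Sys.D
      · simp [Function.iterate_succ_apply, DynSystem.step, hx]
      · simp [Function.iterate_succ_apply, DynSystem.step, hx, hnone, DynSystem.output]
    rw [heq]
    exact (hf (hD.subtype_image ih)).union ((hf hD.compl).inter (MeasurableSet.const _))

theorem DynSystem.measurableSet_trajectory_eq {n : ℕ} {Y : Type*} (Sys : DynSystem n Y)
    (hD : MeasurableSet Sys.D) (hf : Measurable Sys.f)
    (hh : ∀ y : Y, MeasurableSet (Sys.h ⁻¹' {y})) {H : ℕ} (z : Fin H → Y) :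
    MeasurableSet (Sys.trajectory H ⁻¹' {z}) := by
  have : Sys.trajectory H ⁻¹' {z} =
      ⋂ i : Fin H, {x | Sys.output (Sys.step^[(i : ℕ)] (some x)) = z i} := by
    ext x
    simp [funext_iff, DynSystem.trajectory]
  rw [this]
  exact MeasurableSet.iInter fun i => Sys.measurableSet_output_iterate hD hf hh _ _

theorem observed_eq_coverage {n : ℕ} {Y : Type*} (Sys : DynSystem n Y) (ℓ H : ℕ) {N : ℕ}
    (ω : Fin N → Sys.D) (I : Finset (Fin N)) :
    observed Sys ℓ H ω I = coverage (fun y : Fin H → Y => {w : Fin ℓ → Y | Exhibits y w})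
      (fun i => Sys.trajectory H (ω i)) I := by
  ext w
  simp [observed, coverage, SetExhibits, DynSystem.behavAt_eq]

theorem complexity_eq_coverNumber {n : ℕ} {Y : Type*} (Sys : DynSystem n Y) (ℓ H : ℕ) {N : ℕ}
    (ω : Fin N → Sys.D) :
    complexity Sys ℓ H ω = coverNumber (fun y : Fin H → Y => {w : Fin ℓ → Y | Exhibits y w})
      (fun i => Sys.trajectory H (ω i)) := by
  simp only [complexity, coverNumber, observed_eq_coverage]

open Classical in
/-- The probability that a map into a finite type takes a value with a given property. -/
theorem measureReal_preimage_eq_sum {Ω Z : Type*} [MeasurableSpace Ω] [Fintype Z] (μ : Measure Ω)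
    [IsFiniteMeasure μ] {T : Ω → Z} (hT : ∀ z, MeasurableSet (T ⁻¹' {z})) (G : Z → Prop) :
    μ.real {x | G (T x)} = ∑ z, if G z then μ.real (T ⁻¹' {z}) else 0 := by
  have h : {x | G (T x)} = ⋃ z ∈ Finset.univ.filter G, T ⁻¹' {z} := by
    ext x
    simp
  rw [h, measureReal_biUnion_finset ?_ fun z _ => hT z, Finset.sum_filter]
  intro a _ b _ hab
  exact Set.disjoint_left.2 fun x hx hx' => hab (hx.symm.trans hx')

theorem mainTheorem2 {n : ℕ} {Y : Type*} [Finite Y]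
    (Sys : DynSystem n Y)
    (hD : MeasurableSet Sys.D) (hf : Measurable Sys.f)
    (hh : ∀ y : Y, MeasurableSet (Sys.h ⁻¹' {y}))
    (P : Measure Sys.D) [IsProbabilityMeasure P]
    (ℓ H N : ℕ) (hℓ : 1 ≤ ℓ) (hH : ℓ ≤ H) (hN : 1 ≤ N)
    (β : ℝ) (hβ0 : 0 < β) (hβ1 : β < 1) :
    1 - β ≤ (Measure.pi fun _ : Fin N => P).real
      {ω : Fin N → Sys.D |
        1 - scenarioEps (complexity Sys ℓ H ω) N β ≤
          P.real {x : Sys.D |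
            Sys.behavAt H x ⊆ (dataAbstraction Sys hℓ H ω).behav H}} := by

  classical
  have : Fintype Y := Fintype.ofFinite Y
  have hT := Sys.measurableSet_trajectory_eq hD hf hh (H := H)
  let L : (Fin H → Y) → Set (Fin ℓ → Y) := fun y => {w | Exhibits y w}
  let q : (Fin H → Y) → ℝ := fun z => P.real (Sys.trajectory H ⁻¹' {z})
  let T : (Fin N → Sys.D) → Fin N → Fin H → Y := fun ω i => Sys.trajectory H (ω i)
  have hpre : ∀ z, T ⁻¹' {z} = Set.univ.pi fun i => Sys.trajectory H ⁻¹' {z i} := by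
    intro z
    ext ω
    simp [T, funext_iff]
  have hTm : ∀ z, MeasurableSet (T ⁻¹' {z}) := fun z => by
    rw [hpre]
    exact MeasurableSet.univ_pi fun i => hT (z i)
  have hTq : ∀ z, (Measure.pi fun _ : Fin N => P).real (T ⁻¹' {z}) = ∏ i, q (z i) := fun z => by
    rw [hpre, measureReal_def, Measure.pi_pi, ENNReal.toReal_prod]
    rfl
  have hq : ∀ z, 0 ≤ q z := fun z => measureReal_nonneg
  have hq1 : ∑ z, q z = 1 := by
    have := measureReal_preimage_eq_sum P hT fun _ => True
    simpa [q] using this.symm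
  have hcov : ∀ S, P.real {x | L (Sys.trajectory H x) ⊆ S} = coveredWeight L q S := fun S =>
    measureReal_preimage_eq_sum P hT fun z => L z ⊆ S
  let bad : (Fin N → Fin H → Y) → Prop := fun z =>
    coveredWeight L q (coverage L z Finset.univ) < 1 - scenarioEps (coverNumber L z) N β
  have hbad : (Measure.pi fun _ : Fin N => P).real {ω | bad (T ω)} ≤ β := by
    rw [measureReal_preimage_eq_sum _ hTm bad]
    simp only [hTq]
    exact sum_prod_violation_le L hq hq1 hN hβ0 hβ1
  have hbadm : MeasurableSet {ω | bad (T ω)} := by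
    have h : {ω | bad (T ω)} = ⋃ z ∈ {z | bad z}, T ⁻¹' {z} := by
      ext ω
      simp
    rw [h]
    exact MeasurableSet.biUnion (Set.to_countable _) fun z _ => hTm z
  calc 1 - β ≤ (Measure.pi fun _ : Fin N => P).real {ω | bad (T ω)}ᶜ := by
        rw [probReal_compl_eq_one_sub hbadm]
        linarith
    _ ≤ _ := by
        -- Only an inclusion is needed here, so the target event need not be shown measurable.
        refine measureReal_mono fun ω hω => ?_
        have hω' : 1 - scenarioEps (coverNumber L (T ω)) N β ≤
            coveredWeight L q (coverage L (T ω) Finset.univ) := not_lt.1 hω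
        rw [Set.mem_ofPred_eq, complexity_eq_coverNumber]
        refine hω'.trans ?_
        rw [← hcov]
        refine measureReal_mono fun x hx => ?_
        rw [Set.mem_ofPred_eq, DynSystem.behavAt_eq, Set.singleton_subset_iff]
        refine mem_behav_completeAbstraction hℓ hH ?_
        rw [observed_eq_coverage]
        exact hx
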